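/- Let $\mathbb{T}=\mathbb{R}/\mathbb{Z}$ be the circle with its usual distance $d$, and let $\mathbb{T}^\infty=\mathbb{T}^{\mathbb{N}}$ carry the uniform probability measure $\sigma$, that is, the completed product of the uniform probability measures on the circles. For $x,y\in\mathbb{T}^\infty$ put $$ d(x,y)=\Bigl(\sum_{i} d(x_i,y_i)^2\Bigr)^{1/2}\in[0,\infty]. $$ A parallel infinite-dimensional subtorus is a set $$ M=\{x\in\mathbb{T}^\infty : x_i=b_i \text{ for all } i\in\mathbb{N}\setminus A\}, $$ where $A\subseteq\mathbb{N}$ is infinite and $b:\mathbb{N}\setminus A\to\mathbb{T}$; it carries the uniform probability measure of $\mathbb{T}^A$ (completed), with respect to which $L^\infty(M)$ is understood. Let $f:\mathbb{T}^\infty\to\mathbb{R}$ be a function that is measurable with respect to $\sigma$ and Lipschitz with respect to $d$: there is $K\in\mathbb{R}$ with $|f(x)-f(y)|\le K\,d(x,y)$ for all $x,y$ with $d(x,y)<\infty$. Then there exists $a\in\mathbb{R}$ with the following property: for every $\varepsilon>0$ there is a parallel infinite-dimensional subtorus $M\subseteq\mathbb{T}^\infty$ such that the restriction $f|_M$ is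 measurable and $$ \|f-a\|_{L^\infty(M)}<\varepsilon. $$ -/

import Mathlib

open MeasureTheory
open scoped NNReal ENNReal

namespace InfTorus

/-- The infinite-dimensional torus: all sequences of points of the circle `ℝ / ℤ`. -/
abbrev Torus : Type := ℕ → UnitAddCircle

/-- The uniform probability measure on the torus `(ℝ / ℤ) ^ ι`: the product of the uniform
probability measures on the circles. -/
noncomputable def uniform (ι : Type) : Measure (ι → UnitAddCircle) :=
  Measure.infinitePi fun _ : ι => (volume : Measure UnitAddCircle)

/-- The uniform measure on the circle has total mass one. -/
theorem isProbabilityMeasure_circle : IsProbabilityMeasure (volume : Measure UnitAddCircle) :=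
  ⟨UnitAddCircle.measure_univ⟩

/-- The uniform measure on a torus has total mass one. -/
instance instIsProbabilityMeasureUniform (ι : Type) : IsProbabilityMeasure (uniform ι) := by
  have := isProbabilityMeasure_circle
  unfold uniform
  infer_instance

/-- The Euclidean distance on the infinite-dimensional torus, which may take the value `∞`. -/
noncomputable def eucDist (x y : Torus) : ℝ≥0∞ :=
  (∑' i, edist (x i) (y i) ^ 2) ^ (1 / 2 : ℝ)

/-- `f` is Lipschitz for the Euclidean distance. There is no constraint on pairs of points at
infinite distance. -/
def IsEucLipschitz (f : Torus → ℝ) : Prop :=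
  ∃ K : ℝ, ∀ x y : Torus, eucDist x y ≠ ∞ → |f x - f y| ≤ K * (eucDist x y).toReal

/-- A parallel infinite-dimensional subtorus: the coordinates in the infinite set `free` are
arbitrary, and those outside `free` have the prescribed values `base`. -/
structure ParallelSubtorus where
  free : Set ℕ
  free_infinite : free.Infinite
  base : (freeᶜ : Set ℕ) → UnitAddCircle

namespace ParallelSubtorus

/-- The set of points of the subtorus. -/
def carrier (M : ParallelSubtorus) : Set Torus :=
  {x | ∀ i : (M.freeᶜ : Set ℕ), x i = M.base i}

open Classical in
/-- The parametrization of the subtorus by its free coordinates. -/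
noncomputable def param (M : ParallelSubtorus) (t : M.free → UnitAddCircle) : Torus :=
  fun i => if h : i ∈ M.free then t ⟨i, h⟩ else M.base ⟨i, h⟩

theorem param_injective (M : ParallelSubtorus) : Function.Injective M.param := by
  intro s t h
  funext i
  have := congrFun h i
  simpa [param] using this

theorem range_param (M : ParallelSubtorus) : Set.range M.param = M.carrier := by
  ext x
  constructor
  · rintro ⟨t, rfl⟩ ⟨i, hi⟩
    have hi' : i ∉ M.free := hi
    simp [param, hi']
  · intro hx
    refine ⟨fun i => x i, ?_⟩
    funext i
    by_cases h : i ∈ M.free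
    · simp [param, h]
    · simpa [param, h] using (hx ⟨i, h⟩).symm

theorem measurable_param (M : ParallelSubtorus) : Measurable M.param := by
  refine measurable_pi_lambda _ fun i => ?_
  by_cases h : i ∈ M.free
  · simpa [param, h] using measurable_pi_apply (⟨i, h⟩ : M.free)
  · simp [param, h]

/-- The uniform probability measure on the subtorus, as a measure on the ambient torus which is
carried by `M.carrier`. -/
noncomputable def measure (M : ParallelSubtorus) : Measure Torus :=
  (uniform M.free).map M.param

instance instIsProbabilityMeasureMeasure (M : ParallelSubtorus) : IsProbabilityMeasure M.measure :=
  Measure.isProbabilityMeasure_map M.measurable_param.aemeasurable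

end ParallelSubtorus

end InfTorus

/-!
A measurable function on the torus is close in measure to continuous functions for the product
topology, and such a function hardly feels a translation in the `n`-th coordinate when `n` is large
(`tendsto_measure_translate_single`). If `f` is moreover Lipschitz and `F` is a finite set of
coordinates, then compactness of the finite-dimensional torus over `F ∪ {n}` makes this uniform:
for large `n`, off a set of small measure, `f` varies by at most `δ` along the `n`-th circle,
wherever the coordinates in `F` are placed (`eventually_measure_not_insensitive_le`).

Coordinates `n₀, n₁, …` are chosen recursively, with `F k = {n₀, …, n₍ₖ₋₁₎}` and summable `δ k` and
exceptional measures. Since insensitivity at stage `k` ignores the coordinates in `F k ∪ {nₖ}`, at a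
point that is insensitive at all stages one may reset `n₀`, then `n₁`, and so on: finitely many
changes of coordinates in `A = {n₀, n₁, …}` alter `f` by at most `ε` (`exists_infinite_insensitive`).

Points of this kind at which `f` lies in one narrow band around some value `a` form a set of
positive measure. By Fubini it has positive measure in some subtorus with free coordinates `A`
(`exists_subtorus_measure_ne_zero`), and by the zero-one law (`ae_exists_mem_finite_ne`) almost
every point of that subtorus is a finite change of a point of the set; hence `f` is close to `a`
almost everywhere there. The set can be taken inside `{|f| ≤ R}` with `R` independent of `ε`, so the
values `a` stay bounded, and a limit point of them as `ε → 0` serves all `ε`.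
-/

open Filter Topology Function

namespace InfTorus

/-! ### Lipschitz bounds -/

theorem eucDist_update (x : Torus) (n : ℕ) (t : UnitAddCircle) :
    eucDist x (update x n t) = edist (x n) t := by
  unfold eucDist
  rw [tsum_eq_single n (fun i hi => by simp [hi])]
  simp only [update_self, one_div]
  rw [← ENNReal.rpow_natCast, ← ENNReal.rpow_mul]
  simp

/-- The Lipschitz condition, applied one coordinate at a time; the `ℓ¹` bound is weaker than the
Euclidean one but suffices on a fixed finite set of coordinates. -/
theorem abs_sub_le_mul_sum {f : Torus → ℝ} {K : ℝ}
    (hK : ∀ x y : Torus, eucDist x y ≠ ∞ → |f x - f y| ≤ K * (eucDist x y).toReal)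
    (F : Finset ℕ) (x y : Torus) (h : ∀ i ∉ F, x i = y i) :
    |f x - f y| ≤ K * ∑ i ∈ F, dist (x i) (y i) := by
  induction F using Finset.induction_on generalizing x with
  | empty => simp [show x = y from funext fun i => h i (by simp)]
  | insert n F hn ih =>
    have h1 : |f x - f (update x n (y n))| ≤ K * dist (x n) (y n) := by
      have := hK x (update x n (y n))
      rw [eucDist_update] at this
      simpa [edist_dist, ENNReal.toReal_ofReal dist_nonneg] using this (edist_ne_top _ _)
    have h2 := ih (update x n (y n)) fun i hi => by
      by_cases hin : i = n
      · subst hin; simp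
      · simpa [hin] using h i (by simp [hin, hi])
    have h3 : ∑ i ∈ F, dist (update x n (y n) i) (y i) = ∑ i ∈ F, dist (x i) (y i) :=
      Finset.sum_congr rfl fun i hi => by
        rw [update_of_ne (fun h : i = n => hn (h ▸ hi))]
    rw [Finset.sum_insert hn, mul_add, ← h3]
    exact (abs_sub_le _ _ _).trans (add_le_add h1 h2)

/-! ### Translations of the torus -/

instance instIsAddLeftInvariantUniform (ι : Type) : (uniform ι).IsAddLeftInvariant := by
  have := isProbabilityMeasure_circle
  refine ⟨fun u => ?_⟩
  have h := Measure.infinitePi_map_pi (fun _ : ι => (volume : Measure UnitAddCircle))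
    (f := fun i s => u i + s) (fun i => measurable_const_add _)
  simp only [map_add_left_eq_self] at h
  exact h

/-! ### Approximation in measure by continuous functions -/

theorem exists_measure_lt_abs_le {X : Type*} [MeasurableSpace X] {μ : Measure X}
    [IsFiniteMeasure μ] {f : X → ℝ} (hf : AEMeasurable f μ) {η : ℝ≥0∞} (hη : 0 < η) :
    ∃ R : ℝ, μ {x | R < |f x|} ≤ η := by
  have h := tendsto_measure_iInter_atTop (μ := μ) (s := fun n : ℕ => {x | (n : ℝ) < |f x|})
    (fun n => nullMeasurableSet_lt aemeasurable_const (by simpa using hf.norm))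
    (fun m n hmn x (hx : (n : ℝ) < |f x|) =>
      lt_of_le_of_lt (Nat.cast_le.2 hmn : (m : ℝ) ≤ n) hx) ⟨0, measure_ne_top _ _⟩
  have h0 : ⋂ n : ℕ, {x | (n : ℝ) < |f x|} = ∅ := by
    refine Set.eq_empty_iff_forall_notMem.2 fun x hx => ?_
    obtain ⟨n, hn⟩ := exists_nat_ge |f x|
    exact absurd (Set.mem_iInter.1 hx n) (not_lt.2 hn)
  rw [h0, measure_empty] at h
  obtain ⟨n, hn⟩ := (h.eventually (gt_mem_nhds hη)).exists
  exact ⟨n, hn.le⟩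

theorem exists_boundedContinuous_measure_le {X : Type*} [TopologicalSpace X] [NormalSpace X]
    [MeasurableSpace X] [BorelSpace X] {μ : Measure X} [IsFiniteMeasure μ] [μ.WeaklyRegular]
    {f : X → ℝ} (hf : AEMeasurable f μ) {δ : ℝ} (hδ : 0 < δ) {η : ℝ≥0∞} (hη : 0 < η) :
    ∃ g : BoundedContinuousFunction X ℝ, μ {x | δ ≤ |f x - g x|} ≤ η := by
  obtain ⟨R, hR⟩ := exists_measure_lt_abs_le hf (ENNReal.half_pos hη.ne')
  -- Truncation makes the function integrable.
  set h : X → ℝ := fun x => max (-|R|) (min (f x) |R|) with hh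
  have hhm : AEMeasurable h μ := aemeasurable_const.max (hf.min aemeasurable_const)
  have hmem : MemLp h 1 μ := by
    refine MemLp.of_bound hhm.aestronglyMeasurable |R| (ae_of_all _ fun x => ?_)
    rw [Real.norm_eq_abs, abs_le]
    exact ⟨le_max_left _ _, max_le (neg_le_self (abs_nonneg _)) (min_le_right _ _)⟩
  have hc : 0 < ENNReal.ofReal δ * (η / 2) :=
    ENNReal.mul_pos (ENNReal.ofReal_pos.2 hδ).ne' (ENNReal.half_pos hη.ne').ne'
  obtain ⟨g, hg, hgm⟩ := hmem.exists_boundedContinuous_eLpNorm_sub_le ENNReal.one_ne_top hc.ne'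
  refine ⟨g, ?_⟩
  have hsub : {x | δ ≤ |f x - g x|} ⊆
      {x | R < |f x|} ∪ {x | ENNReal.ofReal δ ≤ ‖(h - g) x‖ₑ} := by
    intro x hx
    by_cases hxR : R < |f x|
    · exact Or.inl hxR
    · right
      have hfx := abs_le.1 ((not_lt.1 hxR).trans (le_abs_self R))
      have : h x = f x := by simp [hh, hfx.1, hfx.2]
      simp only [Set.mem_ofPred_eq, Pi.sub_apply, this, Real.enorm_eq_ofReal_abs]
      exact ENNReal.ofReal_le_ofReal hx
  have hm := mul_meas_ge_le_pow_eLpNorm' μ one_ne_zero ENNReal.one_ne_top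
    (hmem.sub hgm).aestronglyMeasurable (ENNReal.ofReal δ)
  simp only [ENNReal.toReal_one, ENNReal.rpow_one] at hm
  have hm2 := (ENNReal.mul_le_mul_iff_right (ENNReal.ofReal_pos.2 hδ).ne'
    ENNReal.ofReal_ne_top).1 (hm.trans hg)
  calc _ ≤ _ := measure_mono hsub
    _ ≤ _ := measure_union_le _ _
    _ ≤ η / 2 + η / 2 := add_le_add hR hm2
    _ = η := ENNReal.add_halves η

/-- A translation in a far-away coordinate moves a continuous function very little, because
`x + Pi.single n t` converges to `x` in the product topology; approximation in measure by
continuous functions then gives the same for a measurable function. -/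
theorem tendsto_measure_translate_single {f : Torus → ℝ} (hf : AEMeasurable f (uniform ℕ))
    {δ : ℝ} (hδ : 0 < δ) (t : UnitAddCircle) :
    Tendsto (fun n => uniform ℕ {x | δ < |f (Pi.single n t + x) - f x|}) atTop (𝓝 0) := by
  refine ENNReal.tendsto_atTop_zero.2 fun η hη => ?_
  obtain ⟨g, hg⟩ := exists_boundedContinuous_measure_le hf (div_pos hδ three_pos)
    (ENNReal.div_pos hη.ne' (by simp : (3 : ℝ≥0∞) ≠ ∞))
  have hx (x : Torus) : Tendsto (fun n => Pi.single n t + x) atTop (𝓝 x) := by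
    refine tendsto_pi_nhds.2 fun i => tendsto_const_nhds.congr' ?_
    filter_upwards [eventually_gt_atTop i] with n hn
    simp [Pi.single_eq_of_ne hn.ne]
  have hgt : TendstoInMeasure (uniform ℕ) (fun n x => g (Pi.single n t + x)) atTop g :=
    tendstoInMeasure_of_tendsto_ae
      (fun n => (g.continuous.comp (continuous_const_add _)).aestronglyMeasurable)
      (ae_of_all _ fun x => (g.continuous.tendsto x).comp (hx x))
  obtain ⟨N, hN⟩ := ENNReal.tendsto_atTop_zero.1
    (hgt (ENNReal.ofReal (δ / 3)) (by positivity)) (η / 3) (ENNReal.div_pos hη.ne' (by simp))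
  refine ⟨N, fun n hn => ?_⟩
  have htr : uniform ℕ ((Pi.single n t + ·) ⁻¹' {x | δ / 3 ≤ |f x - g x|}) ≤ η / 3 := by
    rwa [measure_preimage_add]
  have hsub : {x | δ < |f (Pi.single n t + x) - f x|} ⊆
      ((Pi.single n t + ·) ⁻¹' {x | δ / 3 ≤ |f x - g x|} ∪ {x | δ / 3 ≤ |f x - g x|}) ∪
        {x | ENNReal.ofReal (δ / 3) ≤ edist (g (Pi.single n t + x)) (g x)} := by
    intro x hx
    simp only [Set.mem_union, Set.mem_preimage, Set.mem_ofPred_eq, edist_dist,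
      Real.dist_eq] at hx ⊢
    by_contra! hcon
    obtain ⟨⟨h1, h2⟩, h3⟩ := hcon
    replace h3 := (ENNReal.ofReal_lt_ofReal_iff (by positivity)).1 h3
    rw [abs_lt] at h1 h2 h3
    rcases lt_abs.1 hx with h | h <;> linarith [h1.1, h1.2, h2.1, h2.2, h3.1, h3.2]
  calc _ ≤ _ := measure_mono hsub
    _ ≤ η / 3 + η / 3 + η / 3 := (measure_union_le _ _).trans
        (add_le_add ((measure_union_le _ _).trans (add_le_add htr hg)) (hN n hn))
    _ = η := ENNReal.add_thirds η

/-! ### Insensitivity to far-away coordinates -/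

/-- At `x`, the function `f` varies by at most `δ` along the `n`-th circle, uniformly over all
positions of the coordinates in `F`. This property of `x` does not depend on the coordinates of `x`
in `F ∪ {n}`. -/
def Insensitive (f : Torus → ℝ) (F : Finset ℕ) (n : ℕ) (δ : ℝ) (x : Torus) : Prop :=
  ∀ p q : Torus, (∀ i, i ∉ F → i ≠ n → p i = x i) → (∀ i, i ≠ n → q i = p i) → |f p - f q| ≤ δ

/-- Finitely many positions of the coordinates in `F` suffice up to a small error. -/
theorem exists_finset_net (F : Finset ℕ) {r : ℝ} (hr : 0 < r) :
    ∃ U : Finset Torus, ∀ z : Torus, (∀ i ∉ F, z i = 0) →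
      ∃ u ∈ U, (∀ i ∉ F, u i = 0) ∧ ∀ i ∈ F, dist (z i) (u i) < r := by
  have hclosed : IsClosed {z : Torus | ∀ i ∉ F, z i = 0} := by
    simp only [Set.ofPred_forall]
    exact isClosed_iInter fun i => isClosed_iInter fun _ =>
      isClosed_eq (continuous_apply i) continuous_const
  obtain ⟨U, hU, hcov⟩ := hclosed.isCompact.elim_nhds_subcover
    (fun u => {z | ∀ i ∈ F, dist (z i) (u i) < r}) fun u _ =>
      F.eventually_all.2 fun i _ =>
        (isOpen_lt ((continuous_apply i).dist continuous_const) continuous_const).mem_nhds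
          (by simpa using hr)
  refine ⟨U, fun z hz => ?_⟩
  obtain ⟨u, hu, hzu⟩ := Set.mem_iUnion₂.1 (hcov hz)
  exact ⟨u, hu, hU u hu, hzu⟩

/-- By the Lipschitz condition, insensitivity at `x` only has to be tested on finitely many
translates of `x`, and the number of these does not depend on `n`. -/
theorem eventually_measure_not_insensitive_le {f : Torus → ℝ} (hf : AEMeasurable f (uniform ℕ))
    (hlip : IsEucLipschitz f) (F : Finset ℕ) {δ : ℝ} (hδ : 0 < δ) {η : ℝ≥0∞} (hη : 0 < η) :
    ∀ᶠ n in atTop, uniform ℕ {x | ¬ Insensitive f F n δ x} ≤ η := by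
  obtain ⟨K₀, hK₀⟩ := hlip
  obtain ⟨K, hKpos, hK⟩ : ∃ K : ℝ, 0 < K ∧
      ∀ x y : Torus, eucDist x y ≠ ∞ → |f x - f y| ≤ K * (eucDist x y).toReal :=
    ⟨|K₀| + 1, by positivity, fun x y h => (hK₀ x y h).trans (mul_le_mul_of_nonneg_right
      (by linarith [le_abs_self K₀]) ENNReal.toReal_nonneg)⟩
  -- A mesh for which replacing a point by a nearby net point changes `f` by at most `δ / 4`.
  obtain ⟨r, hrpos, hb⟩ : ∃ r : ℝ, 0 < r ∧ K * ((F.card + 1) * r) = δ / 4 :=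
    ⟨δ / (4 * K * (F.card + 1)), by positivity, by field_simp⟩
  obtain ⟨U, hU⟩ := exists_finset_net F hrpos
  obtain ⟨P, -, hP⟩ := (isCompact_univ (X := UnitAddCircle)).elim_nhds_subcover
    (fun s => Metric.ball s r) fun s _ => Metric.ball_mem_nhds s hrpos
  set bad : ℕ → Torus × UnitAddCircle → Set Torus := fun n w =>
    (w.1 + ·) ⁻¹' {x | δ / 4 < |f (Pi.single n w.2 + x) - f x|} with hbad
  have hlim : Tendsto (fun n => ∑ w ∈ U ×ˢ P, uniform ℕ (bad n w)) atTop (𝓝 0) := by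
    rw [← Finset.sum_const_zero (s := U ×ˢ P)]
    refine tendsto_finsetSum _ fun w _ => ?_
    simp only [hbad, measure_preimage_add]
    exact tendsto_measure_translate_single hf (by positivity) w.2
  filter_upwards [hlim.eventually (gt_mem_nhds hη), eventually_gt_atTop (F.sup id)] with n hn hFn
  have hnF : n ∉ F := fun h => absurd (Finset.le_sup (f := id) h) (not_le.2 hFn)
  refine (measure_mono ?_).trans ((measure_biUnion_finset_le (U ×ˢ P) (bad n)).trans hn.le)
  intro x hx
  by_contra hgood
  have hgood' : ∀ u ∈ U, ∀ t ∈ P, |f (Pi.single n t + (u + x)) - f (u + x)| ≤ δ / 4 := by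
    intro u hu t ht
    by_contra! hcon
    exact hgood (Set.mem_biUnion (x := (u, t)) (by simp [hu, ht]) hcon)
  refine hx fun p q hp hq => ?_
  obtain ⟨u, hu, hu0, hur⟩ := hU (fun i => if i ∈ F then p i - x i else 0) fun i hi => by simp [hi]
  -- Moving `y` to the net costs `δ / 4`, and so does removing the translation along the `n`-th circle.
  have key : ∀ y : Torus, (∀ i, i ≠ n → y i = p i) → |f y - f (u + x)| ≤ δ / 2 := by
    intro y hy
    obtain ⟨t, ht, hyt⟩ := Set.mem_iUnion₂.1 (hP (Set.mem_univ (y n - x n)))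
    have hsum : ∑ i ∈ insert n F, dist (y i) ((Pi.single n t + (u + x) : Torus) i) ≤
        (F.card + 1) * r := by
      have : ∀ i ∈ insert n F, dist (y i) ((Pi.single n t + (u + x) : Torus) i) ≤ r := by
        intro i hi
        rcases Finset.mem_insert.1 hi with rfl | hi
        · have := (Metric.mem_ball.1 hyt).le
          have e : y i - (Pi.single i t + (u + x) : Torus) i = y i - x i - t := by
            simp only [Pi.add_apply, Pi.single_eq_same, hu0 i hnF]
            abel
          rwa [dist_eq_norm, e, ← dist_eq_norm]
        · have hin : i ≠ n := fun h => hnF (h ▸ hi)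
          have := (hur i hi).le
          have e : y i - (Pi.single n t + (u + x) : Torus) i = p i - x i - u i := by
            simp only [Pi.add_apply, Pi.single_eq_of_ne hin, hy i hin]
            abel
          rw [dist_eq_norm, e, ← dist_eq_norm]
          simpa [hi] using this
      refine (Finset.sum_le_card_nsmul _ _ _ this).trans ?_
      simp [Finset.card_insert_of_notMem hnF]
    have hd := abs_sub_le_mul_sum hK (insert n F) y (Pi.single n t + (u + x)) fun i hi => by
      simp only [Finset.mem_insert, not_or] at hi
      simp [hi.1, hu0 i hi.2, hy i hi.1, hp i hi.2 hi.1]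
    have := hgood' u hu t ht
    have h3 := abs_sub_le (f y) (f (Pi.single n t + (u + x))) (f (u + x))
    have h4 := mul_le_mul_of_nonneg_left hsum hKpos.le
    linarith
  have h1 := key p fun i _ => rfl
  have h2 := key q hq
  rw [abs_sub_comm] at h2
  linarith [abs_sub_le (f p) (f (u + x)) (f q)]

/-- Starting from `x`, one coordinate at a time is moved to its value in `y`, in the
order in which the coordinates were chosen: the condition at stage `k` ignores the coordinates that
have already been moved. -/
theorem abs_sub_le_of_insensitive {f : Torus → ℝ} {F : ℕ → Finset ℕ} {n : ℕ → ℕ} {δ : ℕ → ℝ}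
    (hF0 : F 0 = ∅) (hF : ∀ k, F (k + 1) = insert (n k) (F k)) {x : Torus}
    (hx : ∀ k, Insensitive f (F k) (n k) (δ k) x) (k : ℕ) (y : Torus)
    (hy : ∀ i ∉ F k, y i = x i) : |f y - f x| ≤ ∑ j ∈ Finset.range k, δ j := by
  induction k generalizing y with
  | zero => simp [show y = x from funext fun i => hy i (by simp [hF0])]
  | succ k ih =>
    have h1 : |f y - f (update y (n k) (x (n k)))| ≤ δ k :=
      hx k _ _ (fun i hi hin => hy i (by simp [hF, hi, hin])) fun i hi => by simp [hi]
    have h2 := ih (update y (n k) (x (n k))) fun i hi => by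
      by_cases hin : i = n k
      · subst hin; simp
      · simpa [hin] using hy i (by simp [hF, hi, hin])
    rw [Finset.sum_range_succ]
    linarith [abs_sub_le (f y) (f (update y (n k) (x (n k)))) (f x)]

/-- There is an infinite set of coordinates such that, off a set of small measure, finitely many
changes of these coordinates alter `f` by at most `ε`. -/
theorem exists_infinite_insensitive {f : Torus → ℝ} (hf : AEMeasurable f (uniform ℕ))
    (hlip : IsEucLipschitz f) {ε : ℝ} (hε : 0 < ε) {η : ℝ≥0∞} (hη : 0 < η) :
    ∃ A : Set ℕ, A.Infinite ∧ ∃ B : Set Torus, uniform ℕ B ≤ η ∧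
      ∀ x ∉ B, ∀ y : Torus, {i | y i ≠ x i}.Finite → (∀ i ∉ A, y i = x i) → |f y - f x| ≤ ε := by
  obtain ⟨δ, hδpos, c, hδ, hc⟩ := NNReal.exists_pos_sum_of_countable
    (ε := ε.toNNReal) (by simpa using hε) ℕ
  obtain ⟨η', hη'pos, hη'⟩ := ENNReal.exists_pos_sum_of_countable' hη.ne' ℕ
  have hstep : ∀ (F : Finset ℕ) (k : ℕ), ∃ n, n ∉ F ∧
      uniform ℕ {x | ¬ Insensitive f F n (δ k) x} ≤ η' k := by
    intro F k
    obtain ⟨n, h1, h2⟩ := ((eventually_measure_not_insensitive_le hf hlip F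
      (NNReal.coe_pos.2 (hδpos k)) (hη'pos k)).and (eventually_gt_atTop (F.sup id))).exists
    exact ⟨n, fun h => absurd (Finset.le_sup (f := id) h) (not_le.2 h2), h1⟩
  choose next hnext hmeas using hstep
  obtain ⟨F, hF0, hF⟩ : ∃ F : ℕ → Finset ℕ, F 0 = ∅ ∧
      ∀ k, F (k + 1) = insert (next (F k) k) (F k) :=
    ⟨fun k => Nat.rec ∅ (fun k G => insert (next G k) G) k, rfl, fun _ => rfl⟩
  have hmono : Monotone F := monotone_nat_of_le_succ fun k => by
    rw [hF]; exact Finset.subset_insert _ _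
  have hcard : ∀ k, (F k).card = k := by
    intro k
    induction k with
    | zero => simp [hF0]
    | succ k ih => rw [hF, Finset.card_insert_of_notMem (hnext _ _), ih]
  refine ⟨⋃ k : ℕ, (F k : Set ℕ), fun hfin => ?_,
    ⋃ k, {x | ¬ Insensitive f (F k) (next (F k) k) (δ k) x}, ?_, ?_⟩
  · have hle : F (hfin.toFinset.card + 1) ⊆ hfin.toFinset := fun i hi =>
      hfin.mem_toFinset.2 (Set.mem_iUnion.2 ⟨_, hi⟩)
    have := Finset.card_le_card hle
    rw [hcard] at this
    omega
  · exact (measure_iUnion_le _).trans ((ENNReal.tsum_le_tsum fun k => hmeas _ _).trans hη'.le)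
  · intro x hx y hfin hy
    simp only [Set.mem_iUnion, Set.mem_ofPred_eq, not_exists, not_not] at hx
    -- All the changed coordinates occur at some finite stage.
    obtain ⟨k, hk⟩ : ∃ k, ∀ i ∈ {i | y i ≠ x i}, i ∈ F k := by
      have hsub : (hfin.toFinset : Set ℕ) ⊆ ⋃ k : ℕ, (F k : Set ℕ) := fun i hi => by
        by_contra hcon
        exact (hfin.mem_toFinset.1 hi) (hy i hcon)
      obtain ⟨k, hk⟩ := Directed.exists_mem_subset_of_finset_subset_biUnion
        (f := fun k => (F k : Set ℕ)) (Monotone.directed_le fun _ _ h => hmono h) hsub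
      exact ⟨k, fun i hi => hk (hfin.mem_toFinset.2 hi)⟩
    refine (abs_sub_le_of_insensitive hF0 hF hx k y fun i hi => ?_).trans ?_
    · by_contra hcon
      exact hi (hk i hcon)
    · have h1 := sum_le_hasSum (Finset.range k) (fun _ _ => zero_le) hδ
      have h2 := h1.trans hc.le
      have := NNReal.coe_le_coe.2 h2
      rwa [NNReal.coe_sum, Real.coe_toNNReal _ hε.le] at this

/-! ### The zero-one law for finite changes of coordinates -/

theorem denseRange_ratCast_circle : DenseRange fun q : ℚ => ((q : ℝ) : UnitAddCircle) :=
  (QuotientAddGroup.mk_surjective.denseRange).comp Rat.denseRange_cast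
    (AddCircle.continuous_mk' 1)

theorem denseRange_finsupp_rat (ι : Type) :
    DenseRange fun (q : ι →₀ ℚ) (i : ι) => ((q i : ℝ) : UnitAddCircle) := by
  classical
  refine fun x => mem_closure_iff.2 fun O hO hx => ?_
  obtain ⟨I, u, hu, hsub⟩ := isOpen_pi_iff.1 hO x hx
  have hex : ∀ i : ι, ∃ q : ℚ, i ∈ I → ((q : ℝ) : UnitAddCircle) ∈ u i := by
    intro i
    by_cases hi : i ∈ I
    · obtain ⟨q, hq⟩ := denseRange_ratCast_circle.exists_mem_open (hu i hi).1 ⟨_, (hu i hi).2⟩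
      exact ⟨q, fun _ => hq⟩
    · exact ⟨0, fun h => absurd h hi⟩
  choose q hq using hex
  exact ⟨_, hsub fun i hi => by simpa [Finset.mem_coe.1 hi] using hq i hi,
    Finsupp.indicator I fun i _ => q i, rfl⟩

/-- Almost every point becomes a point of a given set of positive measure after finitely many
changes of coordinates: the countable dense group of finitely supported rational translations acts
ergodically on the torus. -/
theorem ae_exists_mem_finite_ne {ι : Type} [Countable ι] {E : Set (ι → UnitAddCircle)}
    (hE : MeasurableSet E) (hpos : uniform ι E ≠ 0) :
    ∀ᵐ x ∂uniform ι, ∃ y ∈ E, {i | y i ≠ x i}.Finite := by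
  set v : (ι →₀ ℚ) → ι → UnitAddCircle := fun q i => ((q i : ℝ) : UnitAddCircle) with hv
  have hadd : ∀ p q, v (p + q) = v p + v q := by
    intro p q
    funext i
    simp [hv]
  set T : Set (ι → UnitAddCircle) := ⋃ q, (v q + ·) ⁻¹' E with hT
  have hTm : MeasurableSet T := MeasurableSet.iUnion fun q => measurable_const_add _ hE
  have hinv : ∀ p, (fun x => v p +ᵥ x) ⁻¹' T = T := by
    intro p
    ext x
    simp only [hT, Set.mem_preimage, Set.mem_iUnion, vadd_eq_add, ← add_assoc, ← hadd]
    exact (Equiv.addRight p).exists_congr_left.trans (by simp)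
  have hconst : EventuallyConst T (ae (uniform ι)) :=
    aeconst_of_dense_setOfPred_preimage_vadd_eq (M := ι → UnitAddCircle) hTm.nullMeasurableSet
      ((denseRange_finsupp_rat ι).mono (Set.range_subset_iff.2 hinv))
  have hTpos : ¬ ∀ᵐ x ∂uniform ι, x ∉ T := fun h => by
    refine hpos (measure_mono_null (fun x hx => ?_) h)
    simp only [Set.mem_compl_iff, Set.mem_ofPred_eq, not_not]
    exact Set.mem_iUnion.2 ⟨0, by simpa [show v 0 = 0 from funext fun i => by simp [hv]] using hx⟩
  filter_upwards [(eventuallyConst_set.1 hconst).resolve_right hTpos] with x hx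
  obtain ⟨q, hq⟩ := Set.mem_iUnion.1 hx
  refine ⟨_, hq, q.support.finite_toSet.subset fun i hi => ?_⟩
  simp only [Set.mem_ofPred_eq, Pi.add_apply, ne_eq, add_eq_right] at hi
  refine Finset.mem_coe.2 (Finsupp.mem_support_iff.2 fun h => hi ?_)
  simp only [hv, h, Rat.cast_zero, AddCircle.coe_zero]

/-! ### Slicing by parallel subtori -/

open Classical in
/-- The uniform measure disintegrates over the subtori whose free coordinates are those in `A`. -/
theorem measurePreserving_param {A : Set ℕ} (hA : A.Infinite) :
    MeasurePreserving (fun p : ((Aᶜ : Set ℕ) → UnitAddCircle) × (A → UnitAddCircle) =>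
      (ParallelSubtorus.mk A hA p.1).param p.2)
      ((uniform (Aᶜ : Set ℕ)).prod (uniform A)) (uniform ℕ) := by
  have := isProbabilityMeasure_circle
  have hm : Measurable (fun p : ((Aᶜ : Set ℕ) → UnitAddCircle) × (A → UnitAddCircle) =>
      (ParallelSubtorus.mk A hA p.1).param p.2) := by
    refine measurable_pi_lambda _ fun i => ?_
    by_cases h : i ∈ A
    · simp only [ParallelSubtorus.param, h, dite_true]
      exact (measurable_pi_apply (⟨i, h⟩ : A)).comp measurable_snd
    · simp only [ParallelSubtorus.param, h, dite_false]
      exact (measurable_pi_apply (⟨i, h⟩ : (Aᶜ : Set ℕ))).comp measurable_fst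
  refine ⟨hm, Measure.eq_infinitePi _ fun s t ht => ?_⟩
  rw [Measure.map_apply hm (.pi s.countable_toSet fun i _ => ht i)]
  have hpre : (fun p : ((Aᶜ : Set ℕ) → UnitAddCircle) × (A → UnitAddCircle) =>
      (ParallelSubtorus.mk A hA p.1).param p.2) ⁻¹' (Set.pi s t) =
      Set.pi (s.subtype (· ∈ Aᶜ) : Set (Aᶜ : Set ℕ)) (fun i => t i) ×ˢ
        Set.pi (s.subtype (· ∈ A) : Set A) (fun i => t i) := by
    ext p
    simp only [Set.mem_preimage, Set.mem_pi, Finset.mem_coe, Set.mem_prod, Finset.mem_subtype,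
      Subtype.forall, ParallelSubtorus.param]
    constructor
    · intro h
      exact ⟨fun i hi his => by simpa [show i ∉ A from hi] using h i his,
        fun i hi his => by simpa [hi] using h i his⟩
    · intro h i his
      by_cases hi : i ∈ A
      · simpa [hi] using h.2 i hi his
      · simpa [hi] using h.1 i hi his
  rw [hpre, Measure.prod_prod, uniform, uniform,
    Measure.infinitePi_pi _ (t := fun i : (Aᶜ : Set ℕ) => t i) fun i _ => ht i,
    Measure.infinitePi_pi _ (t := fun i : A => t i) fun i _ => ht i,
    Finset.prod_subtype_eq_prod_filter (fun i => volume (t i)),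
    Finset.prod_subtype_eq_prod_filter (fun i => volume (t i)), mul_comm]
  exact Finset.prod_filter_mul_prod_filter_not s (· ∈ A) fun i => volume (t i)

/-- A set of positive measure has a slice of positive measure, which may be chosen so that a given
null set is also null on it. -/
theorem exists_subtorus_measure_ne_zero {A : Set ℕ} (hA : A.Infinite) {S N : Set Torus}
    (hS : MeasurableSet S) (hSpos : uniform ℕ S ≠ 0) (hN : MeasurableSet N)
    (hN0 : uniform ℕ N = 0) :
    ∃ M : ParallelSubtorus, M.free = A ∧ M.measure S ≠ 0 ∧ M.measure N = 0 := by
  have hslice : ∀ {E : Set Torus}, MeasurableSet E → (uniform ℕ E = 0 ↔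
      ∀ᵐ y ∂uniform (Aᶜ : Set ℕ), (ParallelSubtorus.mk A hA y).measure E = 0) := by
    intro E hE
    have hmp := measurePreserving_param hA
    rw [← hmp.measure_preimage hE.nullMeasurableSet,
      Measure.measure_prod_null (hmp.measurable hE)]
    refine eventually_congr (Eventually.of_forall fun y => ?_)
    rw [ParallelSubtorus.measure, Measure.map_apply (ParallelSubtorus.measurable_param _) hE]
    rfl
  by_contra! hcon
  refine hSpos ((hslice hS).2 ?_)
  filter_upwards [(hslice hN).1 hN0] with y hy
  by_contra hpos
  exact hcon _ rfl hpos hy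

/-- The zero-one law on a subtorus. The property `p` need not be measurable, hence the formulation
through the parametrization. -/
theorem ae_param_of_measure_ne_zero (M : ParallelSubtorus) {S : Set Torus} (hS : MeasurableSet S)
    (hpos : M.measure S ≠ 0) {p : Torus → Prop}
    (h : ∀ x ∈ S, ∀ y : Torus, {i | y i ≠ x i}.Finite → (∀ i ∉ M.free, y i = x i) → p y) :
    ∀ᵐ t ∂uniform M.free, p (M.param t) := by
  rw [ParallelSubtorus.measure, Measure.map_apply M.measurable_param hS] at hpos
  filter_upwards [ae_exists_mem_finite_ne (M.measurable_param hS) hpos] with t ht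
  obtain ⟨s, hs, hfin⟩ := ht
  refine h _ hs _ ((hfin.image Subtype.val).subset fun i hi => ?_) fun i hi => by
    simp [ParallelSubtorus.param, hi]
  by_cases hiM : i ∈ M.free
  · exact ⟨⟨i, hiM⟩, by simpa [ParallelSubtorus.param, hiM, eq_comm] using hi, rfl⟩
  · simp [ParallelSubtorus.param, hiM] at hi

/-! ### Almost constant restrictions -/

/-- For a fixed precision the restriction of `f` to some subtorus is almost constant. The bound `R`
on the constant does not depend on the precision, which allows a passage to the limit. -/
theorem exists_ae_abs_sub_le {f : Torus → ℝ} (hf : AEMeasurable f (uniform ℕ))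
    (hlip : IsEucLipschitz f) {R : ℝ} (hR : uniform ℕ {x | R < |f x|} ≤ 4⁻¹)
    {ε : ℝ} (hε : 0 < ε) :
    ∃ a ∈ Set.Icc (-R) R, ∃ M : ParallelSubtorus, AEMeasurable f M.measure ∧
      ∀ᵐ x ∂M.measure, |f x - a| ≤ 2 * ε := by
  obtain ⟨A, hA, B, hB, hAB⟩ := exists_infinite_insensitive hf hlip hε
    (η := 4⁻¹) (by simp)
  obtain ⟨f', hf'm, hff'⟩ := hf
  set N := toMeasurable (uniform ℕ) {x | f x ≠ f' x} with hN
  have hN0 : uniform ℕ N = 0 := (measure_toMeasurable _).trans hff'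
  set Z := toMeasurable (uniform ℕ) (B ∪ {x | R < |f x|}) with hZ
  -- The points where `f` is bounded by `R`, insensitive to changes in `A`, and equal to `f'`.
  set S := (Z ∪ N)ᶜ with hSdef
  have hSm : MeasurableSet S :=
    ((measurableSet_toMeasurable _ _).union (measurableSet_toMeasurable _ _)).compl
  have hZN : uniform ℕ (Z ∪ N) < 1 := by
    refine (measure_union_le _ _).trans_lt ?_
    rw [hN0, add_zero, hZ, measure_toMeasurable]
    refine ((measure_union_le _ _).trans (add_le_add hB hR)).trans_lt ?_
    have : (4⁻¹ : ℝ≥0∞) = ENNReal.ofReal 4⁻¹ := by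
      rw [ENNReal.ofReal_inv_of_pos (by norm_num)]; simp
    rw [this, ← ENNReal.ofReal_add (by norm_num) (by norm_num), ENNReal.ofReal_lt_one]
    norm_num
  have hSpos : uniform ℕ S ≠ 0 := fun h => by
    have h1 := prob_add_prob_compl (μ := uniform ℕ) hSm.of_compl
    rw [← hSdef, h, add_zero] at h1
    exact hZN.ne h1
  have hS : ∀ x ∈ S, x ∉ B ∧ |f x| ≤ R ∧ f x = f' x := by
    intro x hx
    simp only [hSdef, Set.mem_compl_iff, Set.mem_union, not_or] at hx
    have h1 : x ∉ B ∪ {x | R < |f x|} := fun h => hx.1 (subset_toMeasurable _ _ h)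
    have h2 : x ∉ {x | f x ≠ f' x} := fun h => hx.2 (subset_toMeasurable _ _ h)
    simp only [Set.mem_union, not_or, Set.mem_ofPred_eq, not_lt, ne_eq, not_not] at h1 h2
    exact ⟨h1.1, h1.2, h2⟩
  -- One of the countably many level bands of width `ε` meets `S` in positive measure.
  obtain ⟨c, hc⟩ : ∃ c : ℤ, uniform ℕ (S ∩ {x | ⌊f' x / ε⌋ = c}) ≠ 0 := by
    by_contra! hcon
    refine hSpos (measure_mono_null (fun x hx => ?_) (measure_iUnion_null hcon))
    exact Set.mem_iUnion.2 ⟨_, hx, rfl⟩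
  have hcm : MeasurableSet (S ∩ {x | ⌊f' x / ε⌋ = c}) :=
    hSm.inter ((hf'm.div_const ε).floor (measurableSet_singleton c))
  obtain ⟨x₀, hx₀, hx₀c⟩ := nonempty_of_measure_ne_zero hc
  obtain ⟨M, rfl, hMS, hMN⟩ := exists_subtorus_measure_ne_zero hA hcm hc
    (measurableSet_toMeasurable _ _) hN0
  have hMf : f =ᵐ[M.measure] f' := measure_mono_null (subset_toMeasurable _ _) hMN
  refine ⟨f x₀, abs_le.1 (hS x₀ hx₀).2.1, M, ⟨f', hf'm, hMf⟩, ?_⟩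
  have hparam : ∀ᵐ t ∂uniform M.free, |f (M.param t) - f x₀| ≤ 2 * ε := by
    refine ae_param_of_measure_ne_zero M hcm hMS (p := fun x => |f x - f x₀| ≤ 2 * ε)
      fun x hx y hfin hy => ?_
    have h1 := hAB x (hS x hx.1).1 y hfin hy
    have h2 := Int.abs_sub_lt_one_of_floor_eq_floor (hx.2.trans hx₀c.symm)
    rw [← sub_div, abs_div, abs_of_pos hε, div_lt_one hε, ← (hS x hx.1).2.2,
      ← (hS x₀ hx₀).2.2] at h2
    linarith [abs_sub_le (f y) (f x) (f x₀)]
  have hf' : ∀ᵐ x ∂M.measure, |f' x - f x₀| ≤ 2 * ε := by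
    refine (ae_map_iff M.measurable_param.aemeasurable
      (measurableSet_le (hf'm.sub_const _).abs measurable_const)).2 ?_
    filter_upwards [hparam, ae_of_ae_map M.measurable_param.aemeasurable hMf] with t ht hft
    rwa [← hft]
  filter_upwards [hf', hMf] with x hx hfx
  rwa [hfx]

end InfTorus

theorem theorem1 (f : InfTorus.Torus → ℝ)
    (hmeas : NullMeasurable f (InfTorus.uniform ℕ))
    (hlip : InfTorus.IsEucLipschitz f) :
    ∃ a : ℝ, ∀ ε : ℝ, 0 < ε → ∃ M : InfTorus.ParallelSubtorus,
      NullMeasurable f M.measure ∧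
      eLpNorm (fun x => f x - a) ∞ M.measure < ENNReal.ofReal ε := by
  have hf := hmeas.aemeasurable
  obtain ⟨R, hR⟩ := InfTorus.exists_measure_lt_abs_le hf (η := 4⁻¹) (by simp)
  choose a haR M hM hMa using fun n : ℕ => InfTorus.exists_ae_abs_sub_le hf hlip hR
    (Nat.one_div_pos_of_nat (α := ℝ) (n := n))
  -- The constants for the precisions `1 / (n + 1)` lie in a compact interval; `a'` is a limit point.
  obtain ⟨a', -, φ, hφ, ha'⟩ := isCompact_Icc.tendsto_subseq haR
  refine ⟨a', fun ε hε => ?_⟩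
  have hlim : Tendsto (fun k => 2 * (1 / ((φ k : ℝ) + 1)) + |a (φ k) - a'|) atTop (𝓝 0) := by
    have h1 := ((tendsto_one_div_add_atTop_nhds_zero_nat (𝕜 := ℝ)).comp
      hφ.tendsto_atTop).const_mul 2
    have h2 := (ha'.sub_const a').abs
    simpa using h1.add h2
  obtain ⟨k, hk⟩ := (hlim.eventually (gt_mem_nhds hε)).exists
  refine ⟨M (φ k), (hM _).nullMeasurable, lt_of_le_of_lt ?_
    ((ENNReal.ofReal_lt_ofReal_iff hε).2 hk)⟩
  rw [eLpNorm_exponent_top]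
  refine eLpNormEssSup_le_of_ae_bound ?_
  filter_upwards [hMa (φ k)] with x hx
  rw [Real.norm_eq_abs]
  linarith [abs_sub_le (f x) (a (φ k)) a']
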